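/- Let $g_2=1$, $g_3=0$. There is a lattice $\Lambda\subset\mathbb{C}$ with these invariants, that is, with $60\sum_{0\ne\lambda\in\Lambda}\lambda^{-4}=1$ and $140\sum_{0\ne\lambda\in\Lambda}\lambda^{-6}=0$, and for some $r>0$ the initial value problem $$s'=c^3,\qquad c'=-s^3,\qquad s(0)=0,\quad c(0)=1$$ has a holomorphic solution pair $(s,c)$ on the disc $|z|<r$. Let $\Lambda$ be any lattice with these invariants and $\wp$ its Weierstrass function. Then $(\wp^2-\tfrac14)/(\wp^2+\tfrac14)$ is an elliptic function, meromorphic on $\mathbb{C}$ and with every element of $\Lambda$ as a period. If $(s,c)$ is a holomorphic solution of the initial value problem on a connected open set $U\ni 0$ (in particular, on a disc about $0$), then the square $C=c^2$ satisfies $$C=\frac{\wp^2-\frac14}{\wp^2+\frac14}\quad\text{on } U:$$ at every $z\in U\setminus\Lambda$ one has $\wp(z)^2+\tfrac14\neq 0$ and the equality holds at $z$; at every $z\in U\cap\Lambda$ (in particular at $z=0$) the right side has a removable singularity with limit $C(z)$. Thus $c^2$ extends to this elliptic function. -/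

import Mathlib

/-- `s` and `c` are holomorphic on the open set `U`, which contains `0`, and solve there the
initial value problem `s' = c ^ 3`, `c' = -s ^ 3`, `s 0 = 0`, `c 0 = 1`. -/
structure IsSolutionIVP (U : Set ℂ) (s c : ℂ → ℂ) : Prop where
  isOpen : IsOpen U
  zero_mem : (0 : ℂ) ∈ U
  hasDerivAt_s : ∀ z ∈ U, HasDerivAt s (c z ^ 3) z
  hasDerivAt_c : ∀ z ∈ U, HasDerivAt c (-(s z ^ 3)) z
  s_zero : s 0 = 0
  c_zero : c 0 = 1

/-- `f` is an elliptic function with respect to the period lattice of `L`: it is meromorphic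
on `ℂ` and every element of the lattice is a period. -/
structure IsElliptic (L : PeriodPair) (f : ℂ → ℂ) : Prop where
  meromorphic : Meromorphic f
  periodic : ∀ l ∈ L.lattice, ∀ z : ℂ, f (z + l) = f z

/-- The function `(℘ ^ 2 - 1 / 4) / (℘ ^ 2 + 1 / 4)`, where `℘` is the Weierstrass function of the
lattice of `L`. Its values at the lattice points (poles of `℘`) and at the zeros of the
denominator are conventional. -/
noncomputable def weierstrassQuotient (L : PeriodPair) (z : ℂ) : ℂ :=
  (L.weierstrassP z ^ 2 - 1 / 4) / (L.weierstrassP z ^ 2 + 1 / 4)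

open Complex Filter Topology

/-! ### Existence of a lattice with `g₂ = 1`, `g₃ = 0` -/

namespace PeriodPair

/-! Both `1 / ℘` and `2 s² / (1 + c²)` satisfy `f' ² = 4 f - f³` near `0` and have the form `z² a`
with `a 0 = 1`: the first by `℘' ² = 4 ℘³ - ℘`, the second by the first integral `s⁴ + c⁴ = 1`. The
equation degenerates at `f = 0`, but this normalization still determines `f`
(`eventuallyEq_of_deriv_sq_eq`), so the two agree. Eliminating `s` gives `℘² = (1 + c²) / (4 (1 -
c²))`, which is solved for `c²`; the identity theorem carries the relation over `U`
(`sq_mul_weierstrassP`).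

The lattice is a rescaled square lattice. Solving the initial value problem reduces to the
autonomous equation `s' = (1 - s⁴)^(3/4)`. -/

lemma derivWeierstrassP_half_ω₁ (L : PeriodPair) : L.derivWeierstrassP (L.ω₁ / 2) = 0 := by
  have h := L.derivWeierstrassP_add_coe (-(L.ω₁ / 2)) ⟨L.ω₁, L.ω₁_mem_lattice⟩
  rw [show -(L.ω₁ / 2) + L.ω₁ = L.ω₁ / 2 by ring, derivWeierstrassP_neg] at h
  exact self_eq_neg.mp h

lemma isPreconnected_compl_lattice (L : PeriodPair) :
    IsPreconnected ((L.lattice : Set ℂ)ᶜ) := by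
  have hc : (L.lattice : Set ℂ).Countable := by
    have : Countable L.lattice := L.latticeEquivProd.toEquiv.countable_iff.mpr inferInstance
    exact Set.to_countable _
  exact (hc.isPathConnected_compl_of_one_lt_rank
    (by simp [Complex.rank_real_complex])).isConnected.isPreconnected

lemma not_eventually_weierstrassP_eq_zero (L : PeriodPair) {w : ℂ} (hw : w ∉ L.lattice) :
    ¬ ∀ᶠ z in 𝓝 w, L.weierstrassP z = 0 := by
  intro h
  have hz := L.analyticOnNhd_weierstrassP.eqOn_of_preconnected_of_eventuallyEq
    (analyticOnNhd_const (v := 0)) L.isPreconnected_compl_lattice hw h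
  refine L.not_continuousAt_weierstrassP 0 (zero_mem _) ?_
  -- The default value of `℘` at lattice points is also `0`, so `℘` would be continuous at its pole.
  have h0 : L.weierstrassP = fun _ ↦ 0 := by
    ext z
    by_cases hzL : z ∈ L.lattice
    · exact L.weierstrassP_coe ⟨z, hzL⟩
    · exact hz hzL
  rw [h0]
  exact continuousAt_const

/-- The two invariants of a lattice do not vanish simultaneously. -/
lemma g₂_ne_zero_of_g₃_eq_zero (L : PeriodPair) (h₃ : L.g₃ = 0) : L.g₂ ≠ 0 := by
  intro h₂
  set w := L.ω₁ / 2
  have hw : w ∉ L.lattice := L.ω₁_div_two_notMem_lattice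
  have hode (z : ℂ) (hz : z ∉ L.lattice) :
      L.derivWeierstrassP z ^ 2 = 4 * L.weierstrassP z ^ 3 := by
    simpa [h₂, h₃] using L.derivWeierstrassP_sq z hz
  have hf : AnalyticAt ℂ L.weierstrassP w := L.analyticOnNhd_weierstrassP w hw
  have hf0 : L.weierstrassP w = 0 := by
    have := hode w hw
    rw [L.derivWeierstrassP_half_ω₁] at this
    simpa using this.symm
  have htop : analyticOrderAt L.weierstrassP w ≠ ⊤ :=
    fun h ↦ L.not_eventually_weierstrassP_eq_zero hw (analyticOrderAt_eq_top.mp h)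
  obtain ⟨n, hn⟩ := ENat.ne_top_iff_exists.mp htop
  have hn0 : n ≠ 0 := by
    rintro rfl
    exact (hf.analyticOrderAt_eq_zero.mp hn.symm) hf0
  obtain ⟨m, rfl⟩ := Nat.exists_eq_succ_of_ne_zero hn0
  have hd : analyticOrderAt L.derivWeierstrassP w = m := by
    have := hf.analyticOrderAt_deriv_add_one
    simp only [deriv_weierstrassP, hf0, sub_zero, ← hn] at this
    simpa using this
  have hev : L.derivWeierstrassP ^ 2 =ᶠ[𝓝 w] (fun _ ↦ 4) * L.weierstrassP ^ 3 := by
    filter_upwards [L.isClosed_lattice.isOpen_compl.mem_nhds hw] with z hz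
    simpa using hode z hz
  -- If `℘` vanishes to order `m + 1` at the half period, then `℘' ² = 4 ℘³` forces `2 m = 3 (m +
  -- 1)`.
  have hord := analyticOrderAt_congr hev
  have h4 : analyticOrderAt (fun _ : ℂ ↦ (4 : ℂ)) w = 0 :=
    analyticAt_const.analyticOrderAt_eq_zero.mpr (by norm_num)
  rw [analyticOrderAt_pow (L.analyticOnNhd_derivWeierstrassP w hw),
    analyticOrderAt_mul analyticAt_const (hf.pow 3), analyticOrderAt_pow hf, hd, ← hn, h4] at hord
  norm_cast at hord
  simp at hord
  norm_cast at hord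
  omega

/-- The square lattice `ℤ t + ℤ i t`. -/
noncomputable def square (t : ℂ) (ht : t ≠ 0) : PeriodPair where
  ω₁ := t
  ω₂ := t * I
  indep := by
    rw [LinearIndependent.pair_iff]
    intro a b h
    have h' : t * (a + b * I) = 0 := by
      simp only [real_smul] at h
      linear_combination h
    have := (mul_eq_zero.mp h').resolve_left ht
    simpa [Complex.ext_iff] using this

lemma G_eq_tsum_prod (L : PeriodPair) (n : ℕ) :
    L.G n = ∑' p : ℤ × ℤ, ((p.1 * L.ω₁ + p.2 * L.ω₂) ^ n)⁻¹ := by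
  rw [G, ← L.latticeEquivProd.symm.toEquiv.tsum_eq]
  refine tsum_congr fun p ↦ ?_
  rw [← L.latticeEquiv_symm_apply p]
  rfl

lemma G_square (t : ℂ) (ht : t ≠ 0) (n : ℕ) :
    (square t ht).G n = (t ^ n)⁻¹ * (square 1 one_ne_zero).G n := by
  simp only [G_eq_tsum_prod, square, ← tsum_mul_left]
  refine tsum_congr fun p ↦ ?_
  rw [← mul_inv, ← mul_pow]
  ring_nf

lemma G_six_square (t : ℂ) (ht : t ≠ 0) : (square t ht).G 6 = 0 := by
  rw [← self_eq_neg]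
  -- Multiplication by `I` on the lattice, in coordinates `(m, n) ↦ (-n, m)`; it multiplies sixth
  -- powers by `I ^ 6 = -1`.
  let e : ℤ × ℤ ≃ ℤ × ℤ := (Equiv.prodComm ℤ ℤ).trans ((Equiv.neg ℤ).prodCongr (Equiv.refl ℤ))
  conv_lhs => rw [G_eq_tsum_prod, ← e.tsum_eq]
  rw [G_eq_tsum_prod, ← tsum_neg]
  refine tsum_congr fun p ↦ ?_
  have h : ((e p).1 * t + (e p).2 * (t * I) : ℂ) = I * (p.1 * t + p.2 * (t * I)) := by
    simp only [e, Equiv.trans_apply, Equiv.prodComm_apply, Equiv.prodCongr_apply, Prod.map,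
      Prod.fst_swap, Prod.snd_swap, Equiv.neg_apply, Equiv.refl_apply, Int.cast_neg]
    linear_combination (-p.2 * t : ℂ) * I_sq
  have hI : I ^ 6 = -1 := by linear_combination (I ^ 4 - I ^ 2 + 1) * I_sq
  simp only [square, h]
  rw [mul_pow, hI, neg_one_mul, inv_neg]

/-- There is a lattice with `g₂ = 1` and `g₃ = 0`. -/
lemma exists_g₂_eq_one_g₃_eq_zero : ∃ L : PeriodPair, L.g₂ = 1 ∧ L.g₃ = 0 := by
  have h₃ (t : ℂ) (ht : t ≠ 0) : (square t ht).g₃ = 0 := by simp [g₃, G_six_square]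
  have h₂ := (square 1 one_ne_zero).g₂_ne_zero_of_g₃_eq_zero (h₃ _ _)
  obtain ⟨t, ht⟩ := IsAlgClosed.exists_pow_nat_eq (square 1 one_ne_zero).g₂ (n := 4) (by norm_num)
  have ht0 : t ≠ 0 := by
    rintro rfl
    exact h₂ (by simpa using ht.symm)
  refine ⟨square t ht0, ?_, h₃ t ht0⟩
  have : (square t ht0).g₂ = (t ^ 4)⁻¹ * (square 1 one_ne_zero).g₂ := by
    rw [g₂, G_square t ht0, g₂]
    ring
  rw [this, ht, inv_mul_cancel₀ h₂]

end PeriodPair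

/-! ### Local solvability of the initial value problem -/

/-- If `h` is analytic at `0` with `h 0 ≠ 0`, then the autonomous equation `s' = h s`, `s 0 = 0`
has a holomorphic solution near `0`: the local inverse of a primitive of `1 / h`. -/
lemma exists_hasDerivAt_autonomous {h : ℂ → ℂ} (hh : AnalyticAt ℂ h 0) (h0 : h 0 ≠ 0) :
    ∃ s : ℂ → ℂ, s 0 = 0 ∧ ∀ᶠ z in 𝓝 0, HasDerivAt s (h (s z)) z := by
  have hne : ∀ᶠ w in 𝓝 (0 : ℂ), h w ≠ 0 := hh.continuousAt.eventually_ne h0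
  obtain ⟨r, hr, hball⟩ := Metric.eventually_nhds_iff_ball.mp
    (hh.eventually_analyticAt.and hne)
  have hinv : DifferentiableOn ℂ (fun w ↦ (h w)⁻¹) (Metric.ball 0 r) := fun w hw ↦
    ((hball w hw).1.inv (hball w hw).2).differentiableAt.differentiableWithinAt
  obtain ⟨F, hF0, hF⟩ := hinv.isExactOn_ball.with_val_at 0 0
  have hFan : AnalyticAt ℂ F 0 :=
    DifferentiableOn.analyticAt (s := Metric.ball 0 r)
      (fun w hw ↦ (hF w hw).differentiableAt.differentiableWithinAt)
      (Metric.ball_mem_nhds 0 hr)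
  have hF0' : HasDerivAt F (h 0)⁻¹ 0 := hF 0 (Metric.mem_ball_self hr)
  have hcd : ContDiffAt ℂ 1 F 0 := hFan.contDiffAt
  have he := hF0'.hasFDerivAt_equiv (inv_ne_zero h0)
  let s := hcd.localInverse he one_ne_zero
  have hs : ContDiffAt ℂ 1 s (F 0) := hcd.to_localInverse he one_ne_zero
  have hs0 : s (F 0) = 0 := hcd.localInverse_apply_image he one_ne_zero
  have hright : ∀ᶠ y in 𝓝 (F 0), F (s y) = y :=
    (hcd.hasStrictFDerivAt' he one_ne_zero).eventually_right_inverse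
  rw [hF0] at hs hs0 hright
  refine ⟨s, hs0, ?_⟩
  have hsball : ∀ᶠ z in 𝓝 (0 : ℂ), s z ∈ Metric.ball (0 : ℂ) r := by
    have := hs.continuousAt.tendsto
    rw [hs0] at this
    exact this.eventually (Metric.ball_mem_nhds 0 hr)
  filter_upwards [hs.eventually (by simp), hsball, hright.eventually_nhds] with z hz hzb hzr
  simpa using HasDerivAt.of_local_left_inverse hz.continuousAt (hF _ hzb)
    (inv_ne_zero (hball _ hzb).2) hzr

lemma exists_isSolutionIVP :
    ∃ r : ℝ, 0 < r ∧ ∃ s c : ℂ → ℂ, IsSolutionIVP (Metric.ball 0 r) s c := by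
  -- The first integral gives `c = k s`, with the principal branch fixing `c 0 = 1`.
  let k : ℂ → ℂ := fun w ↦ (1 - w ^ 4) ^ (1 / 4 : ℂ)
  have hk0 : k 0 = 1 := by simp [k]
  have hslit : ∀ᶠ w : ℂ in 𝓝 0, 1 - w ^ 4 ∈ slitPlane := by
    have : ContinuousAt (fun w : ℂ ↦ 1 - w ^ 4) 0 := by fun_prop
    exact this.eventually (isOpen_slitPlane.mem_nhds (by simp))
  have hkan : AnalyticAt ℂ k 0 := by
    refine AnalyticAt.cpow (by fun_prop) analyticAt_const (by simp)
  obtain ⟨s, hs0, hs⟩ := exists_hasDerivAt_autonomous (hkan.pow 3) (by simp [hk0])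
  have hscont : ContinuousAt s 0 := hs.self_of_nhds.continuousAt
  have hsslit : ∀ᶠ z in 𝓝 (0 : ℂ), 1 - s z ^ 4 ∈ slitPlane := by
    have := hscont.tendsto
    rw [hs0] at this
    exact this.eventually hslit
  obtain ⟨r, hr, hball⟩ := Metric.eventually_nhds_iff_ball.mp (hs.and hsslit)
  refine ⟨r, hr, s, fun z ↦ k (s z), Metric.isOpen_ball, Metric.mem_ball_self hr,
    fun z hz ↦ (hball z hz).1, fun z hz ↦ ?_, hs0, by simp [hs0, hk0]⟩
  obtain ⟨hsz, hslz⟩ := hball z hz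
  have hne : 1 - s z ^ 4 ≠ 0 := slitPlane_ne_zero hslz
  have hkk : k (s z) ^ 4 = 1 - s z ^ 4 := by
    simp [k]
  have hkne : k (s z) ≠ 0 := by
    intro h
    rw [h] at hkk
    exact hne (by simpa using hkk.symm)
  have hd := ((hsz.pow 4).const_sub 1).cpow_const (c := 1 / 4) hslz
  refine hd.congr_deriv ?_
  have hpow : (1 - s z ^ 4) ^ (1 / 4 - 1 : ℂ) = k (s z) / k (s z) ^ 4 := by
    rw [cpow_sub _ _ hne, cpow_one, hkk]
  simp only [Pi.pow_apply, hpow]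
  field_simp
  push_cast
  ring

/-! ### Uniqueness at the degenerate point -/

/-- Local uniqueness for the equation `f' ^ 2 = 4 f - f ^ 3` among functions `f = z ^ 2 a` with
`a 0 = 1`. -/
lemma eventuallyEq_of_deriv_sq_eq {a b : ℂ → ℂ} (ha : AnalyticAt ℂ a 0) (hb : AnalyticAt ℂ b 0)
    (ha0 : a 0 = 1) (hb0 : b 0 = 1)
    (hda : ∀ᶠ z in 𝓝[≠] 0,
      deriv (fun z ↦ z ^ 2 * a z) z ^ 2 = 4 * (z ^ 2 * a z) - (z ^ 2 * a z) ^ 3)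
    (hdb : ∀ᶠ z in 𝓝[≠] 0,
      deriv (fun z ↦ z ^ 2 * b z) z ^ 2 = 4 * (z ^ 2 * b z) - (z ^ 2 * b z) ^ 3) :
    a =ᶠ[𝓝 0] b := by
  have key {f : ℂ → ℂ} (hf : AnalyticAt ℂ f 0)
      (hdf : ∀ᶠ z in 𝓝[≠] 0,
        deriv (fun z ↦ z ^ 2 * f z) z ^ 2 = 4 * (z ^ 2 * f z) - (z ^ 2 * f z) ^ 3) :
      ∀ᶠ z in 𝓝[≠] 0, (2 * f z + z * deriv f z) ^ 2 = 4 * f z - z ^ 4 * f z ^ 3 := by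
    filter_upwards [hdf, hf.eventually_analyticAt.filter_mono nhdsWithin_le_nhds,
      self_mem_nhdsWithin] with z hz hfz (hz0 : z ≠ 0)
    have hd := ((hasDerivAt_pow 2 z).mul hfz.differentiableAt.hasDerivAt).deriv
    have hd' : deriv (fun z ↦ z ^ 2 * f z) z = z * (2 * f z + z * deriv f z) := by
      refine hd.trans ?_
      push_cast
      ring
    rw [hd'] at hz
    apply mul_left_cancel₀ (pow_ne_zero 2 hz0)
    linear_combination hz
  by_contra hne
  have hab : AnalyticAt ℂ (a - b) 0 := ha.sub hb
  have htop : analyticOrderAt (a - b) 0 ≠ ⊤ := by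
    intro h
    refine hne ((analyticOrderAt_eq_top.mp h).mono fun z hz ↦ ?_)
    exact sub_eq_zero.mp hz
  obtain ⟨g, hg, hg0, hgE⟩ := hab.analyticOrderAt_ne_top.mp htop
  set n := analyticOrderNatAt (a - b) 0
  have hgE' : ∀ᶠ z in 𝓝 (0 : ℂ), a z - b z = z ^ n * g z := by
    filter_upwards [hgE] with z hz
    simpa using hz
  -- With `a - b = z ^ n * g` and `g 0 ≠ 0`, subtract the two equations, factor the differences of
  -- squares and cubes, and cancel `z ^ n`.
  have hlin : ∀ᶠ z in 𝓝[≠] (0 : ℂ),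
      (2 * (a z + b z) + z * (deriv a z + deriv b z)) * ((2 + n) * g z + z * deriv g z) =
        (4 - z ^ 4 * (a z ^ 2 + a z * b z + b z ^ 2)) * g z := by
    filter_upwards [key ha hda, key hb hdb, hgE'.eventually_nhds.filter_mono nhdsWithin_le_nhds,
      ha.eventually_analyticAt.filter_mono nhdsWithin_le_nhds,
      hb.eventually_analyticAt.filter_mono nhdsWithin_le_nhds,
      hg.eventually_analyticAt.filter_mono nhdsWithin_le_nhds,
      self_mem_nhdsWithin] with z h₁ h₂ hE haz hbz hgz (hz0 : z ≠ 0)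
    have hdE : deriv a z - deriv b z = n * z ^ (n - 1) * g z + z ^ n * deriv g z := by
      rw [← deriv_fun_sub haz.differentiableAt hbz.differentiableAt, EventuallyEq.deriv_eq hE]
      exact ((hasDerivAt_pow n z).mul hgz.differentiableAt.hasDerivAt).deriv
    have hn : z * (n * z ^ (n - 1)) = n * z ^ n := by
      rcases n with _ | n
      · simp
      · simp; ring
    apply mul_left_cancel₀ (pow_ne_zero n hz0)
    have hE := Eventually.self_of_nhds hE
    set A := a z
    set B := b z
    have hzdE : z * (deriv a z - deriv b z) = z ^ n * (n * g z + z * deriv g z) := by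
      rw [hdE]
      linear_combination g z * hn
    have h12 : (2 * (A + B) + z * (deriv a z + deriv b z)) *
        (2 * (A - B) + z * (deriv a z - deriv b z)) =
        (4 - z ^ 4 * (A ^ 2 + A * B + B ^ 2)) * (A - B) := by
      linear_combination h₁ - h₂
    rw [hzdE, hE] at h12
    linear_combination h12
  have ha' := ha.deriv.continuousAt
  have hb' := hb.deriv.continuousAt
  have hg' := hg.deriv.continuousAt
  have hac := ha.continuousAt
  have hbc := hb.continuousAt
  have hgc := hg.continuousAt
  have hl : ContinuousAt (fun z ↦ (2 * (a z + b z) + z * (deriv a z + deriv b z)) *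
      ((2 + n) * g z + z * deriv g z)) 0 := by fun_prop
  have hr : ContinuousAt (fun z ↦ (4 - z ^ 4 * (a z ^ 2 + a z * b z + b z ^ 2)) * g z) 0 := by
    fun_prop
  have hlim := tendsto_nhds_unique_of_eventuallyEq (hl.tendsto.mono_left nhdsWithin_le_nhds)
    (hr.tendsto.mono_left nhdsWithin_le_nhds) hlin
  -- At `z = 0` this reads `4 (n + 2) g 0 = 4 g 0`, impossible since `n + 1 ≠ 0`.
  simp only [ha0, hb0] at hlim
  have h3 : (n + 1 : ℂ) * g 0 = 0 := by linear_combination hlim / 4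
  exact hg0 ((mul_eq_zero.mp h3).resolve_left (by exact_mod_cast n.succ_ne_zero))

/-! ### The differential equation for `1 / ℘` -/

namespace PeriodPair

/-- `1 / ℘ = z ^ 2 a` near `0` with `a 0 = 1`. -/
lemma inv_weierstrassP_eq (L : PeriodPair) {z : ℂ} (hz0 : z ≠ 0) :
    z ^ 2 * (1 + z ^ 2 * L.weierstrassPExcept 0 z)⁻¹ = (L.weierstrassP z)⁻¹ := by
  have h := L.weierstrassPExcept_add 0 z
  simp only [ZeroMemClass.coe_zero, sub_zero] at h
  rw [← h]
  field_simp
  simp [add_comm]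

lemma eventually_notMem_lattice (L : PeriodPair) (w : ℂ) : ∀ᶠ z in 𝓝[≠] w, z ∉ L.lattice := by
  filter_upwards [self_mem_nhdsWithin, mem_nhdsWithin_of_mem_nhds
    (L.compl_lattice_sdiff_singleton_mem_nhds w)] with z hz hz'
  simp_all

lemma eventually_weierstrassP_ne_zero (L : PeriodPair) : ∀ᶠ z in 𝓝[≠] 0, L.weierstrassP z ≠ 0 := by
  have han := L.analyticAt_weierstrassPExcept 0
  have hcont : ContinuousAt (fun z ↦ 1 + z ^ 2 * L.weierstrassPExcept 0 z) 0 := by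
    have := han.continuousAt
    fun_prop
  filter_upwards [(hcont.eventually_ne (by simp : (1 + (0 : ℂ) ^ 2 * _) ≠ 0)).filter_mono
    nhdsWithin_le_nhds, self_mem_nhdsWithin] with z hz (hz0 : z ≠ 0) h
  have := L.inv_weierstrassP_eq hz0
  rw [h, inv_zero] at this
  exact mul_ne_zero (pow_ne_zero 2 hz0) (inv_ne_zero hz) this

lemma deriv_inv_weierstrassP_sq (L : PeriodPair) (h₂ : L.g₂ = 1) (h₃ : L.g₃ = 0) :
    ∀ᶠ z in 𝓝[≠] 0,
      deriv (fun z ↦ z ^ 2 * (1 + z ^ 2 * L.weierstrassPExcept 0 z)⁻¹) z ^ 2 =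
        4 * (z ^ 2 * (1 + z ^ 2 * L.weierstrassPExcept 0 z)⁻¹) -
          (z ^ 2 * (1 + z ^ 2 * L.weierstrassPExcept 0 z)⁻¹) ^ 3 := by
  filter_upwards [L.eventually_notMem_lattice 0, L.eventually_weierstrassP_ne_zero,
    self_mem_nhdsWithin] with z hzL hP (hz0 : z ≠ 0)
  have heq : (fun z ↦ z ^ 2 * (1 + z ^ 2 * L.weierstrassPExcept 0 z)⁻¹) =ᶠ[𝓝 z]
      fun z ↦ (L.weierstrassP z)⁻¹ := by
    filter_upwards [isOpen_ne.mem_nhds hz0] with w hw using L.inv_weierstrassP_eq hw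
  have hd := (L.analyticOnNhd_weierstrassP z hzL).differentiableAt
  rw [heq.deriv_eq, L.inv_weierstrassP_eq hz0, deriv_fun_inv'' hd hP, deriv_weierstrassP]
  have := L.derivWeierstrassP_sq z hzL
  rw [h₂, h₃] at this
  field_simp
  linear_combination this

end PeriodPair

/-! ### Comparison of the solution with `℘` -/

namespace IsSolutionIVP

variable {U : Set ℂ} {s c : ℂ → ℂ}

lemma pow_four_add_pow_four (h : IsSolutionIVP U s c) (hU : IsPreconnected U) {z : ℂ}
    (hz : z ∈ U) : s z ^ 4 + c z ^ 4 = 1 := by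
  have hd (w : ℂ) (hw : w ∈ U) : HasDerivAt (fun z ↦ s z ^ 4 + c z ^ 4) 0 w := by
    refine (((h.hasDerivAt_s w hw).pow 4).add ((h.hasDerivAt_c w hw).pow 4)).congr_deriv ?_
    push_cast
    ring
  have := h.isOpen.is_const_of_deriv_eq_zero hU
    (fun w hw ↦ (hd w hw).differentiableAt.differentiableWithinAt) (fun w hw ↦ (hd w hw).deriv)
    hz h.zero_mem
  simpa [h.s_zero, h.c_zero] using this

lemma analyticOnNhd_s (h : IsSolutionIVP U s c) : AnalyticOnNhd ℂ s U :=
  DifferentiableOn.analyticOnNhd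
    (fun z hz ↦ (h.hasDerivAt_s z hz).differentiableAt.differentiableWithinAt) h.isOpen

lemma analyticOnNhd_c (h : IsSolutionIVP U s c) : AnalyticOnNhd ℂ c U :=
  DifferentiableOn.analyticOnNhd
    (fun z hz ↦ (h.hasDerivAt_c z hz).differentiableAt.differentiableWithinAt) h.isOpen

lemma eventually_one_add_sq_ne_zero (h : IsSolutionIVP U s c) :
    ∀ᶠ z in 𝓝 (0 : ℂ), 1 + c z ^ 2 ≠ 0 := by
  have hc := (h.analyticOnNhd_c 0 h.zero_mem).continuousAt
  have : ContinuousAt (fun z ↦ 1 + c z ^ 2) 0 := by fun_prop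
  refine this.eventually_ne ?_
  rw [h.c_zero]
  norm_num

lemma sq_mul_dslope (h : IsSolutionIVP U s c) (z : ℂ) :
    z ^ 2 * (2 * dslope s 0 z ^ 2 / (1 + c z ^ 2)) = 2 * s z ^ 2 / (1 + c z ^ 2) := by
  have : z * dslope s 0 z = s z := by
    simpa [h.s_zero] using sub_smul_dslope s 0 z
  rw [← this]
  ring

/-- By `s⁴ + c⁴ = 1` the derivative collapses to `4 s c / (1 + c²)`. -/
lemma deriv_quotient_sq (h : IsSolutionIVP U s c) (hU : IsPreconnected U) :
    ∀ᶠ z in 𝓝 (0 : ℂ),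
      deriv (fun z ↦ 2 * s z ^ 2 / (1 + c z ^ 2)) z ^ 2 =
        4 * (2 * s z ^ 2 / (1 + c z ^ 2)) - (2 * s z ^ 2 / (1 + c z ^ 2)) ^ 3 := by
  filter_upwards [h.isOpen.mem_nhds h.zero_mem, h.eventually_one_add_sq_ne_zero] with z hz hne
  have h4 := h.pow_four_add_pow_four hU hz
  have hd : HasDerivAt (fun z ↦ 2 * s z ^ 2 / (1 + c z ^ 2)) (4 * s z * c z / (1 + c z ^ 2)) z := by
    refine ((((h.hasDerivAt_s z hz).pow 2).const_mul 2).div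
      (((h.hasDerivAt_c z hz).pow 2).const_add 1) hne).congr_deriv ?_
    simp only [Pi.pow_apply]
    field_simp
    push_cast
    linear_combination 4 * s z * c z * h4
  rw [hd.deriv]
  field_simp
  linear_combination 8 * s z ^ 2 * h4

lemma eventually_inv_weierstrassP_eq (h : IsSolutionIVP U s c) (hU : IsPreconnected U)
    (L : PeriodPair) (h₂ : L.g₂ = 1) (h₃ : L.g₃ = 0) :
    ∀ᶠ z in 𝓝[≠] 0, (L.weierstrassP z)⁻¹ = 2 * s z ^ 2 / (1 + c z ^ 2) := by
  have hsan := h.analyticOnNhd_s 0 h.zero_mem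
  have hcan := h.analyticOnNhd_c 0 h.zero_mem
  have hPan := L.analyticAt_weierstrassPExcept 0
  have hσ : AnalyticAt ℂ (dslope s 0) 0 := by
    obtain ⟨p, hp⟩ := hsan
    exact hp.has_fpower_series_dslope_fslope.analyticAt
  have hσ0 : dslope s 0 0 = 1 := by
    rw [dslope_same, (h.hasDerivAt_s 0 h.zero_mem).deriv, h.c_zero, one_pow]
  have heq := eventuallyEq_of_deriv_sq_eq
    (a := fun z ↦ (1 + z ^ 2 * L.weierstrassPExcept 0 z)⁻¹)
    (b := fun z ↦ 2 * dslope s 0 z ^ 2 / (1 + c z ^ 2))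
    (AnalyticAt.inv (by fun_prop) (by simp))
    (AnalyticAt.div (by fun_prop) (by fun_prop) (h.eventually_one_add_sq_ne_zero.self_of_nhds))
    (by simp) (by simp only [hσ0, h.c_zero]; norm_num)
    (L.deriv_inv_weierstrassP_sq h₂ h₃)
    (by
      simp only [h.sq_mul_dslope]
      exact (h.deriv_quotient_sq hU).filter_mono nhdsWithin_le_nhds)
  filter_upwards [heq.filter_mono nhdsWithin_le_nhds, self_mem_nhdsWithin] with z hz (hz0 : z ≠ 0)
  rw [← L.inv_weierstrassP_eq hz0, ← h.sq_mul_dslope, hz]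

/-- Clearing denominators makes the defect `H` meromorphic on all of `U`, so its infinite order at
`0` propagates across the poles of `℘`. -/
lemma sq_mul_weierstrassP (h : IsSolutionIVP U s c) (hU : IsPreconnected U)
    (L : PeriodPair) (h₂ : L.g₂ = 1) (h₃ : L.g₃ = 0) {z : ℂ} (hz : z ∈ U) (hzL : z ∉ L.lattice) :
    c z ^ 2 * (L.weierstrassP z ^ 2 + 1 / 4) = L.weierstrassP z ^ 2 - 1 / 4 := by
  set H : ℂ → ℂ := fun z ↦
    c z ^ 2 * (L.weierstrassP z ^ 2 + 1 / 4) - (L.weierstrassP z ^ 2 - 1 / 4)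
  have hP := L.meromorphic_weierstrassP
  have hmer : MeromorphicOn H U := by
    intro w hw
    have hc := (h.analyticOnNhd_c w hw).meromorphicAt
    have hPw := hP w
    fun_prop
  have h0 : meromorphicOrderAt H 0 = ⊤ := by
    rw [meromorphicOrderAt_eq_top_iff]
    filter_upwards [h.eventually_inv_weierstrassP_eq hU L h₂ h₃, L.eventually_weierstrassP_ne_zero,
      mem_nhdsWithin_of_mem_nhds (h.isOpen.mem_nhds h.zero_mem),
      h.eventually_one_add_sq_ne_zero.filter_mono nhdsWithin_le_nhds] with w hw hPw hwU hne
    have h4 := h.pow_four_add_pow_four hU hwU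
    have hw' : 1 + c w ^ 2 = 2 * s w ^ 2 * L.weierstrassP w := by
      field_simp at hw
      linear_combination hw
    have hs : 4 * s w ^ 4 ≠ 0 := by
      refine mul_ne_zero (by norm_num) (pow_ne_zero 4 fun hs ↦ hne ?_)
      rw [hw', hs]
      ring
    apply mul_left_cancel₀ hs
    have hsq : 4 * s w ^ 4 * L.weierstrassP w ^ 2 = (1 + c w ^ 2) ^ 2 := by
      rw [hw']
      ring
    simp only [H]
    linear_combination (c w ^ 2 - 1) * hsq + (c w ^ 2 + 1) * h4
  have hzt : meromorphicOrderAt H z = ⊤ := by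
    by_contra hne
    exact (hmer.exists_meromorphicOrderAt_ne_top_iff_forall ⟨⟨0, h.zero_mem⟩, hU⟩).mp
      ⟨⟨z, hz⟩, hne⟩ ⟨0, h.zero_mem⟩ h0
  have hcont : ContinuousAt H z := by
    have := (h.analyticOnNhd_c z hz).continuousAt
    have := (L.analyticOnNhd_weierstrassP z hzL).continuousAt
    fun_prop
  have := tendsto_nhds_unique_of_eventuallyEq (hcont.tendsto.mono_left nhdsWithin_le_nhds)
    (tendsto_const_nhds (x := (0 : ℂ))) (meromorphicOrderAt_eq_top_iff.mp hzt)
  exact sub_eq_zero.mp this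

/-- A zero here would force `℘² - 1/4 = 0` too, but the two expressions differ by `1/2`. -/
lemma weierstrassP_sq_add_ne_zero (h : IsSolutionIVP U s c) (hU : IsPreconnected U)
    (L : PeriodPair) (h₂ : L.g₂ = 1) (h₃ : L.g₃ = 0) {z : ℂ} (hz : z ∈ U) (hzL : z ∉ L.lattice) :
    L.weierstrassP z ^ 2 + 1 / 4 ≠ 0 := by
  intro h0
  have := h.sq_mul_weierstrassP hU L h₂ h₃ hz hzL
  rw [h0, mul_zero] at this
  have h2 : (1 / 2 : ℂ) = 0 := by linear_combination h0 + this
  norm_num at h2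

lemma sq_eq_weierstrassQuotient (h : IsSolutionIVP U s c) (hU : IsPreconnected U)
    (L : PeriodPair) (h₂ : L.g₂ = 1) (h₃ : L.g₃ = 0) {z : ℂ} (hz : z ∈ U) (hzL : z ∉ L.lattice) :
    c z ^ 2 = weierstrassQuotient L z :=
  (eq_div_iff (h.weierstrassP_sq_add_ne_zero hU L h₂ h₃ hz hzL)).mpr
    (h.sq_mul_weierstrassP hU L h₂ h₃ hz hzL)

lemma tendsto_weierstrassQuotient (h : IsSolutionIVP U s c) (hU : IsPreconnected U)
    (L : PeriodPair) (h₂ : L.g₂ = 1) (h₃ : L.g₃ = 0) {z : ℂ} (hz : z ∈ U) :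
    Tendsto (weierstrassQuotient L) (𝓝[≠] z) (𝓝 (c z ^ 2)) := by
  have hc := ((h.analyticOnNhd_c z hz).continuousAt.pow 2).tendsto.mono_left
    (nhdsWithin_le_nhds (s := {z}ᶜ))
  refine hc.congr' ?_
  filter_upwards [L.eventually_notMem_lattice z,
    mem_nhdsWithin_of_mem_nhds (h.isOpen.mem_nhds hz)] with w hwL hwU
  exact h.sq_eq_weierstrassQuotient hU L h₂ h₃ hwU hwL

end IsSolutionIVP

lemma isElliptic_weierstrassQuotient (L : PeriodPair) : IsElliptic L (weierstrassQuotient L) where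
  meromorphic := by
    have := L.meromorphic_weierstrassP
    unfold weierstrassQuotient
    fun_prop
  periodic l hl z := by
    simp only [weierstrassQuotient, L.weierstrassP_add_coe z ⟨l, hl⟩]

theorem theorem6 :
    -- the lemniscatic Weierstrass function exists
    (∃ L : PeriodPair, L.g₂ = 1 ∧ L.g₃ = 0) ∧
    -- the initial value problem is solvable near the origin
    (∃ r : ℝ, 0 < r ∧ ∃ s c : ℂ → ℂ, IsSolutionIVP (Metric.ball 0 r) s c) ∧
    ∀ L : PeriodPair, L.g₂ = 1 → L.g₃ = 0 →
      IsElliptic L (weierstrassQuotient L) ∧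
      ∀ (U : Set ℂ) (s c : ℂ → ℂ), IsPreconnected U → IsSolutionIVP U s c →
        -- equality at the points of `U` that are not poles of `℘`
        (∀ z ∈ U, z ∉ L.lattice →
          L.weierstrassP z ^ 2 + 1 / 4 ≠ 0 ∧
          c z ^ 2 = (L.weierstrassP z ^ 2 - 1 / 4) / (L.weierstrassP z ^ 2 + 1 / 4)) ∧
        -- at the poles of `℘` in `U` (such as `0`), equality after removing the singularity
        (∀ z ∈ U, z ∈ L.lattice →
          Filter.Tendsto (weierstrassQuotient L) (nhdsWithin z {z}ᶜ) (nhds (c z ^ 2))) := by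
  refine ⟨PeriodPair.exists_g₂_eq_one_g₃_eq_zero, exists_isSolutionIVP, fun L h₂ h₃ ↦
    ⟨isElliptic_weierstrassQuotient L, fun U s c hU h ↦ ⟨fun z hz hzL ↦ ?_, fun z hz _ ↦ ?_⟩⟩⟩
  · exact ⟨h.weierstrassP_sq_add_ne_zero hU L h₂ h₃ hz hzL,
      h.sq_eq_weierstrassQuotient hU L h₂ h₃ hz hzL⟩
  · exact h.tendsto_weierstrassQuotient hU L h₂ h₃ hz
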